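/- Every finite simple graph $G$ that is a block graph is a Helly-$B_1$-EPG graph. Here a block of $G$ is a maximal connected subgraph without a cut vertex, and $G$ (not necessarily connected) is a block graph if the vertex set of every block of $G$ is a clique. A graph $G$ is Helly-$B_1$-EPG if one can assign to each vertex $v$ a path $P_v$ (with at least one edge) of the rectangular grid on $\mathbb{Z}^2$ such that: (i) each $P_v$ has at most one bend, i.e. it changes between horizontal and vertical at most once; (ii) two distinct vertices $u,v$ are adjacent in $G$ if and only if $P_u$ and $P_v$ share at least one grid edge; and (iii) the edge sets of the paths $P_v$ satisfy the Helly property: for every nonempty set $S$ of vertices such that the paths $P_v$, $v\in S$, pairwise share a grid edge, there is a grid edge contained in all $P_v$, $v\in S$. -/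

import Mathlib

/-! Edge intersection graphs of paths on a grid, the Helly property, and block graphs. -/

namespace EPG

/-- The rectangular grid with vertex set `ℤ × ℤ`: two points are adjacent when they agree in one
coordinate and differ by exactly one in the other. A finite family of finite paths always lies in a
finite rectangle of it. -/
def gridGraph : SimpleGraph (ℤ × ℤ) where
  Adj p q := (p.1 - q.1).natAbs + (p.2 - q.2).natAbs = 1
  symm := ⟨fun p q h => by omega⟩
  loopless := ⟨fun p h => by omega⟩

/-- A dart (directed edge) of the grid is horizontal when its two ends lie in the same row;
otherwise it is vertical. -/
def isHorizontal (d : gridGraph.Dart) : Bool :=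
  decide (d.fst.2 = d.snd.2)

/-- The number of bends of a walk on the grid: the number of pairs of consecutive edges of the walk
one of which is horizontal and the other vertical. -/
def bends {a b : ℤ × ℤ} (p : gridGraph.Walk a b) : ℕ :=
  (p.darts.zip p.darts.tail).countP fun e => isHorizontal e.1 != isHorizontal e.2

/-- A path of the grid: a walk without repeated grid points that has at least one edge. -/
structure GridPath where
  source : ℤ × ℤ
  target : ℤ × ℤ
  walk : gridGraph.Walk source target
  isPath : walk.IsPath
  length_pos : 0 < walk.length

/-- The set of grid edges covered by a path. -/
def GridPath.edgeSet (P : GridPath) : Set (Sym2 (ℤ × ℤ)) :=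
  {e | e ∈ P.walk.edges}

/-- The number of bends of a grid path. -/
def GridPath.numBends (P : GridPath) : ℕ :=
  bends P.walk

/-- The family `P` of grid paths is an EPG representation of `G`: two distinct vertices are adjacent
if and only if their paths share at least one edge of the grid. -/
def IsEPGRepresentation {V : Type*} (G : SimpleGraph V) (P : V → GridPath) : Prop :=
  ∀ u v : V, u ≠ v → (G.Adj u v ↔ ((P u).edgeSet ∩ (P v).edgeSet).Nonempty)

/-- An EPG representation in which every path has at most `k` bends. -/
def IsBkEPGRepresentation {V : Type*} (k : ℕ) (G : SimpleGraph V) (P : V → GridPath) : Prop :=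
  IsEPGRepresentation G P ∧ ∀ v : V, (P v).numBends ≤ k

/-- The Helly property of a family of sets: every (nonempty) pairwise intersecting subfamily has a
common element. -/
def HellyProperty {ι α : Type*} (F : ι → Set α) : Prop :=
  ∀ S : Set ι, S.Nonempty → (∀ i ∈ S, ∀ j ∈ S, (F i ∩ F j).Nonempty) → (⋂ i ∈ S, F i).Nonempty

/-- `G` is a Helly-`B_k`-EPG graph: it has an EPG representation by paths with at most `k` bends such
that the edge sets of the paths have the Helly property. -/
def IsHellyBkEPG {V : Type*} (k : ℕ) (G : SimpleGraph V) : Prop :=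
  ∃ P : V → GridPath, IsBkEPGRepresentation k G P ∧ HellyProperty fun v => (P v).edgeSet

/-- A vertex `v` of a connected subgraph `H` is a cut vertex when deleting it disconnects `H`.
(The graph without vertices counts as preconnected, so a single vertex has no cut vertex.) -/
def IsCutVertex {V : Type*} {G : SimpleGraph V} (H : G.Subgraph) (v : V) : Prop :=
  v ∈ H.verts ∧ ¬ (H.deleteVerts {v}).Preconnected

/-- A block (biconnected component) of `G`: a maximal connected subgraph without a cut vertex. -/
def IsBlock {V : Type*} (G : SimpleGraph V) (B : G.Subgraph) : Prop :=
  Maximal (fun H : G.Subgraph => H.Connected ∧ ∀ v, ¬ IsCutVertex H v) B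

/-- A block graph: every block is a clique. -/
def IsBlockGraph {V : Type*} (G : SimpleGraph V) : Prop :=
  ∀ B : G.Subgraph, IsBlock G B → G.IsClique B.verts

end EPG

namespace EPG

/-! Layer each component by distance from a root. Cycles of a block graph span cliques, which forces
every non-root vertex to have exactly one neighbour in the previous layer, its parent, and makes
adjacency within a layer transitive (`parent_unique`, `adj_trans`). Thus a block with an edge is a
top vertex together with a group of mutually adjacent children of it.

Every vertex owns a grid line, with orientation alternating between layers. The path of `v` starts
on the line of its parent, at a position shared by its group, and bends onto its own line, which it
follows past all of its children. Groups on one line occupy disjoint intervals, so paths share an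
edge exactly for parent and child or for siblings. In a pairwise intersecting family, the first edge
of the member whose line is furthest out lies on all the paths. -/

/-! ### Grid paths with one bend -/

/-- The grid point with coordinate `i` along the lines of orientation `o` (`true` for horizontal)
and coordinate `c` across them. -/
def linePoint (o : Bool) (i c : ℤ) : ℤ × ℤ :=
  if o then (i, c) else (c, i)

/-- The unit grid edge on the line of orientation `o` at height `c` from position `i` to
position `i + 1`. -/
def lineEdge (o : Bool) (i c : ℤ) : Sym2 (ℤ × ℤ) :=
  s(linePoint o i c, linePoint o (i + 1) c)

theorem linePoint_not (o : Bool) (i c : ℤ) : linePoint (!o) i c = linePoint o c i := by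
  cases o <;> rfl

theorem lineEdge_inj {o o' : Bool} {i i' c c' : ℤ} (h : lineEdge o i c = lineEdge o' i' c') :
    o = o' ∧ i = i' ∧ c = c' := by
  cases o <;> cases o' <;>
    simp only [lineEdge, linePoint, Sym2.eq_iff, Prod.mk.injEq, if_true, Bool.false_eq_true,
      if_false, reduceCtorEq, true_and, false_and] at h ⊢ <;> omega

theorem exists_straight_walk (o : Bool) (c : ℤ) (n : ℕ) : ∀ a b : ℤ, b = a + n →
    ∃ w : gridGraph.Walk (linePoint o a c) (linePoint o b c),
      (∀ e, e ∈ w.edges ↔ ∃ i, a ≤ i ∧ i < b ∧ e = lineEdge o i c) ∧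
      ∀ d ∈ w.darts, isHorizontal d = o ∧ d.snd.1 + d.snd.2 = d.fst.1 + d.fst.2 + 1 := by
  induction n with
  | zero =>
    intro a b h
    obtain rfl : b = a := by simpa using h
    refine ⟨.nil, fun e => ?_, by simp⟩
    simp only [SimpleGraph.Walk.edges_nil, List.not_mem_nil, false_iff]
    rintro ⟨i, h1, h2, -⟩
    omega
  | succ n ih =>
    intro a b h
    push_cast at h
    obtain ⟨w, hw, hd⟩ := ih (a + 1) b (by omega)
    have hadj : gridGraph.Adj (linePoint o a c) (linePoint o (a + 1) c) := by
      cases o <;> simp [gridGraph, linePoint]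
    refine ⟨.cons hadj w, fun e => ?_, ?_⟩
    · rw [SimpleGraph.Walk.edges_cons, List.mem_cons, hw]
      constructor
      · rintro (rfl | ⟨i, h1, h2, rfl⟩)
        · exact ⟨a, le_rfl, by omega, rfl⟩
        · exact ⟨i, by omega, h2, rfl⟩
      · rintro ⟨i, h1, h2, rfl⟩
        rcases h1.eq_or_lt with rfl | h1
        · exact Or.inl rfl
        · exact Or.inr ⟨i, by omega, h2, rfl⟩
    · intro d hdm
      rw [SimpleGraph.Walk.darts_cons, List.mem_cons] at hdm
      rcases hdm with rfl | hdm
      · cases o <;> simp [isHorizontal, linePoint] <;> omega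
      · exact hd d hdm

/-- A walk along which a height strictly increases cannot revisit a vertex; the bound on the support
is what the induction needs. -/
theorem isPath_of_forall_darts_lt {α : Type*} {H : SimpleGraph α} (h : α → ℤ) {a b : α}
    (w : H.Walk a b) (hw : ∀ d ∈ w.darts, h d.fst < h d.snd) :
    w.IsPath ∧ ∀ x ∈ w.support, h a ≤ h x := by
  induction w with
  | nil => simp
  | cons hadj w ih =>
    rw [SimpleGraph.Walk.darts_cons, List.forall_mem_cons] at hw
    obtain ⟨h1, h2⟩ := ih hw.2
    have h0 := hw.1
    dsimp only at h0
    refine ⟨(SimpleGraph.Walk.cons_isPath_iff _ _).2 ⟨h1, fun hm => ?_⟩, ?_⟩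
    · exact absurd (h2 _ hm) (not_le.2 h0)
    · intro x hx
      rw [SimpleGraph.Walk.support_cons, List.mem_cons] at hx
      rcases hx with rfl | hx
      · exact le_rfl
      · exact h0.le.trans (h2 x hx)

theorem countP_zip_tail_eq_zero {α : Type*} (g : α → Bool) (b : Bool) (l : List α)
    (h : ∀ x ∈ l, g x = b) : ((l.zip l.tail).countP fun e => g e.1 != g e.2) = 0 := by
  rw [List.countP_eq_zero]
  rintro ⟨x, y⟩ hxy
  obtain ⟨hx, hy⟩ := List.of_mem_zip hxy
  simp [h x hx, h y (List.mem_of_mem_tail hy)]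

theorem countP_zip_tail_append_le_one {α : Type*} (g : α → Bool) (b b' : Bool) (l l' : List α)
    (h : ∀ x ∈ l, g x = b) (h' : ∀ x ∈ l', g x = b') :
    (((l ++ l').zip (l ++ l').tail).countP fun e => g e.1 != g e.2) ≤ 1 := by
  induction l with
  | nil => simpa using (countP_zip_tail_eq_zero g b' l' h').le.trans zero_le_one
  | cons x l ih =>
    rw [List.forall_mem_cons] at h
    cases l with
    | nil =>
      cases l' with
      | nil => simp
      | cons y l' =>
        have := countP_zip_tail_eq_zero g b' (y :: l') h'
        simp only [List.tail_cons] at this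
        simp only [List.cons_append, List.nil_append, List.tail_cons, List.zip_cons_cons,
          List.countP_cons, this]
        split <;> simp
    | cons y l =>
      have := ih h.2
      simp only [List.cons_append, List.tail_cons] at this
      simp only [List.cons_append, List.tail_cons, List.zip_cons_cons, List.countP_cons]
      have hxy : (g x != g y) = false := by simp [h.1, h.2 y (by simp)]
      simpa [hxy] using this

/-- An L-shaped grid path: along the line at height `q` from `s` to `f`, then along the
perpendicular line at height `f` from `q` to `M`. -/
theorem exists_bent_path (o : Bool) {q s f M : ℤ} (hs : s < f) (hq : q < M) :
    ∃ P : GridPath, P.numBends ≤ 1 ∧ ∀ e, e ∈ P.edgeSet ↔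
      (∃ i, s ≤ i ∧ i < f ∧ e = lineEdge o i q) ∨
      (∃ i, q ≤ i ∧ i < M ∧ e = lineEdge (!o) i f) := by
  obtain ⟨w, hw, hd⟩ := exists_straight_walk o q (f - s).toNat s f (by omega)
  obtain ⟨w', hw', hd'⟩ := exists_straight_walk (!o) f (M - q).toNat q M (by omega)
  -- Both legs go in positive directions, so the coordinate sum serves as height.
  have hpath := (isPath_of_forall_darts_lt (fun x : ℤ × ℤ => x.1 + x.2)
    (w.append (w'.copy (linePoint_not o q f) rfl)) (by
      intro d hdm
      simp only [SimpleGraph.Walk.darts_append, SimpleGraph.Walk.darts_copy, List.mem_append] at hdm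
      rcases hdm with h | h
      · have := (hd d h).2
        omega
      · have := (hd' d h).2
        omega)).1
  refine ⟨⟨_, _, w.append (w'.copy (linePoint_not o q f) rfl), hpath, ?_⟩, ?_, ?_⟩
  · have h : lineEdge o s q ∈ w.edges := (hw _).2 ⟨s, le_rfl, hs, rfl⟩
    have := List.length_pos_of_mem h
    rw [SimpleGraph.Walk.length_edges] at this
    rw [SimpleGraph.Walk.length_append]
    omega
  · simp only [GridPath.numBends, bends, SimpleGraph.Walk.darts_append,
      SimpleGraph.Walk.darts_copy]
    exact countP_zip_tail_append_le_one isHorizontal o (!o) _ _ (fun d h => (hd d h).1)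
      fun d h => (hd' d h).1
  · intro e
    simp [GridPath.edgeSet, hw, hw']

/-! ### From labellings to Helly representations -/

/-- A labelling of the vertices from which one-bend paths can be read off: `f v` is the line owned
by `v`, `q v` the line to which `v` is attached, and `s v` the position on the latter at which the
group of `v` starts. -/
theorem isHellyBkEPG_of_labelling {V : Type*} [Finite V] (G : SimpleGraph V)
    (f q s : V → ℤ) (o : V → Bool) (hf : Function.Injective f)
    (hqs : ∀ v, q v ≤ s v) (hsf : ∀ v, s v < f v)
    (ho : ∀ u v, q v = f u → o v = !o u) (hoq : ∀ u v, q u = q v → o u = o v)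
    (hs : ∀ u v, q u = q v → s u ≠ s v → f u ≤ s v ∨ f v ≤ s u)
    (hG : ∀ u v, u ≠ v → (G.Adj u v ↔ q v = f u ∨ q u = f v ∨ (q u = q v ∧ s u = s v))) :
    IsHellyBkEPG 1 G := by
  obtain ⟨M, hM⟩ : ∃ M, ∀ v, f v < M := by
    obtain ⟨M, hM⟩ := (Set.finite_range f).bddAbove
    exact ⟨M + 1, fun v => Int.lt_add_one_of_le (hM ⟨v, rfl⟩)⟩
  have hP := fun v => exists_bent_path (o v) (hsf v)
    (((hqs v).trans_lt (hsf v)).trans (hM v))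
  choose P hb hP using hP
  -- The first edge of the path of `v` also lies on the paths of its parent and of its siblings.
  have key : ∀ u v, (u = v ∨ q v = f u ∨ (q u = q v ∧ s u = s v)) →
      lineEdge (o v) (s v) (q v) ∈ (P u).edgeSet := by
    rintro u v (rfl | h | ⟨h, h'⟩)
    · exact (hP u _).2 (Or.inl ⟨_, le_rfl, hsf u, rfl⟩)
    · refine (hP u _).2 (Or.inr ⟨s v, ?_, (hsf v).trans (hM v), ?_⟩)
      · have := hqs v
        have := hqs u
        have := hsf u
        omega
      · rw [ho u v h, h]
    · refine (hP u _).2 (Or.inl ⟨s v, h'.le, h' ▸ hsf u, ?_⟩)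
      rw [hoq u v h, h]
  have hrep : IsEPGRepresentation G P := by
    intro u v huv
    rw [hG u v huv]
    constructor
    · rintro (h | h | h)
      · exact ⟨_, key u v (Or.inr (Or.inl h)), key v v (Or.inl rfl)⟩
      · exact ⟨_, key u u (Or.inl rfl), key v u (Or.inr (Or.inl h))⟩
      · exact ⟨_, key u v (Or.inr (Or.inr h)), key v v (Or.inl rfl)⟩
    · rintro ⟨e, hu, hv⟩
      rcases (hP u e).1 hu with ⟨i, hi, hi', rfl⟩ | ⟨i, hi, hi', rfl⟩ <;>
      rcases (hP v _).1 hv with ⟨j, hj, hj', he⟩ | ⟨j, hj, hj', he⟩ <;>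
      obtain ⟨h1, rfl, h3⟩ := lineEdge_inj he
      · refine Or.inr (Or.inr ⟨h3, ?_⟩)
        by_contra hne
        rcases hs u v h3 hne with h | h <;> omega
      · exact Or.inr (Or.inl h3)
      · exact Or.inl h3.symm
      · exact absurd (hf h3) huv
  refine ⟨P, ⟨hrep, hb⟩, ?_⟩
  intro S hS hpair
  -- A child has a larger `f` than its parent, so no other member of `S` is a child of `v`; only its
  -- parent and siblings remain.
  obtain ⟨v, hv, hmax⟩ := S.toFinite.exists_maximalFor f S hS
  refine ⟨lineEdge (o v) (s v) (q v), Set.mem_iInter₂.2 fun u hu => key u v ?_⟩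
  by_cases huv : u = v
  · exact Or.inl huv
  right
  rcases (hG u v huv).1 ((hrep u v huv).2 (hpair u hu v hv)) with h | h | h
  · exact Or.inl h
  · have h1 := hqs u
    have h2 := hsf u
    have h3 := hmax hu (by omega)
    omega
  · exact Or.inr h


/-! ### Cycles in block graphs span cliques -/

theorem preconnected_induce_of_walks {V : Type*} {G : SimpleGraph V} {T : Set V} {c : V}
    (h : ∀ a ∈ T, ∃ w : G.Walk c a, ∀ t ∈ w.support, t ∈ T) : (G.induce T).Preconnected := by
  rintro ⟨a, ha⟩ ⟨b, hb⟩
  obtain ⟨w, hw⟩ := h a ha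
  obtain ⟨w', hw'⟩ := h b hb
  exact ⟨(w.induce T hw).reverse.append (w'.induce T hw')⟩

/-- In a finite block graph, a vertex set inducing a connected graph without a cut vertex is a
clique. -/
theorem IsBlockGraph.isClique_of_preconnected {V : Type*} [Finite V] {G : SimpleGraph V}
    (hG : IsBlockGraph G) {S : Set V} (hS : S.Nonempty) (hc : (G.induce S).Preconnected)
    (h : ∀ z ∈ S, (G.induce (S \ {z})).Preconnected) : G.IsClique S := by
  have hdel : ∀ z, ((⊤ : G.Subgraph).induce S).deleteVerts {z} =
      (⊤ : G.Subgraph).induce (S \ {z}) := by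
    intro z
    ext a b
    · simp
    · simp only [SimpleGraph.Subgraph.induce_verts, SimpleGraph.Subgraph.induce_adj,
        Set.mem_sdiff]
      tauto
  have hne : Nonempty S := hS.to_subtype
  have hconn : ((⊤ : G.Subgraph).induce S).Connected :=
    SimpleGraph.connected_induce_iff.1 ⟨hc⟩
  -- By finiteness the induced subgraph extends to a block, which is a clique.
  obtain ⟨B, hB, hmax⟩ := Finite.exists_le_maximal
    (p := fun H : G.Subgraph => H.Connected ∧ ∀ v, ¬ IsCutVertex H v)
    (a := (⊤ : G.Subgraph).induce S) ⟨hconn, fun z hz => hz.2 (by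
      rw [hdel, ← SimpleGraph.preconnected_induce_iff]
      exact h z hz.1)⟩
  exact (hG B hmax).subset hB.1

/-- In a finite block graph the vertices of a cycle, given as a vertex `v` and a path between two
neighbours of `v`, form a clique. -/
theorem IsBlockGraph.isClique_cycle {V : Type*} [Finite V] {G : SimpleGraph V}
    (hG : IsBlockGraph G) {v x y : V} (q : G.Walk x y) (hq : q.IsPath) (hv : v ∉ q.support)
    (hx : G.Adj v x) (hy : G.Adj v y) : G.IsClique (insert v {a | a ∈ q.support}) := by
  classical
  have hxs : ∀ a (ha : a ∈ q.support), ∀ t ∈ (SimpleGraph.Walk.cons hx (q.takeUntil a ha)).support,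
      t = v ∨ t ∈ (q.takeUntil a ha).support := by simp
  have hys : ∀ a (ha : a ∈ q.support),
      ∀ t ∈ (SimpleGraph.Walk.cons hy (q.dropUntil a ha).reverse).support,
      t = v ∨ t ∈ (q.dropUntil a ha).support := by simp
  refine hG.isClique_of_preconnected ⟨v, Or.inl rfl⟩ ?_ ?_
  · refine preconnected_induce_of_walks (c := v) ?_
    rintro a (rfl | ha)
    · exact ⟨.nil, by simp⟩
    · refine ⟨_, fun t ht => (hxs a ha t ht).imp_right fun h => ?_⟩
      exact q.support_takeUntil_subset_support ha h
  · intro z hz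
    by_cases hzv : z = v
    · subst hzv
      refine preconnected_induce_of_walks (c := x) ?_
      rintro a ⟨rfl | ha, haz⟩
      · exact absurd rfl haz
      · refine ⟨q.takeUntil a ha, fun t ht => ?_⟩
        have ht' := q.support_takeUntil_subset_support ha ht
        exact ⟨Or.inr ht', fun h => hv (h ▸ ht')⟩
    · refine preconnected_induce_of_walks (c := v) ?_
      rintro a ⟨rfl | ha, haz⟩
      · exact ⟨.nil, by simpa using fun h => hzv h.symm⟩
      -- As `q` is a path, `z` blocks at most one of the two ways around the cycle from `v` to `a`.
      · by_cases hzt : z ∈ (q.takeUntil a ha).support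
        · have hzd : z ∉ (q.dropUntil a ha).support := by
            intro hzd
            have hn := hq.support_nodup
            rw [← q.take_spec ha, SimpleGraph.Walk.support_append] at hn
            rw [SimpleGraph.Walk.mem_support_iff] at hzd
            rcases hzd with hzd | hzd
            · exact haz hzd.symm
            · exact List.disjoint_of_nodup_append hn hzt hzd
          refine ⟨.cons hy (q.dropUntil a ha).reverse, fun t ht => ?_⟩
          rcases hys a ha t ht with rfl | h
          · exact ⟨Or.inl rfl, fun h => hzv h.symm⟩
          · exact ⟨Or.inr (q.support_dropUntil_subset_support ha h), fun h' => hzd (h' ▸ h)⟩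
        · refine ⟨.cons hx (q.takeUntil a ha), fun t ht => ?_⟩
          rcases hxs a ha t ht with rfl | h
          · exact ⟨Or.inl rfl, fun h => hzv h.symm⟩
          · exact ⟨Or.inr (q.support_takeUntil_subset_support ha h), fun h' => hzt (h' ▸ h)⟩

/-! ### Layerings of block graphs -/

/-- `d` is a layering of `G`: each component has a single root, in layer `0`, every other vertex
has a neighbour in the previous layer, and adjacent vertices lie in equal or consecutive layers. -/
structure IsLayering {V : Type*} (G : SimpleGraph V) (d : V → ℕ) : Prop where
  le_add_one : ∀ ⦃u v⦄, G.Adj u v → d u ≤ d v + 1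
  exists_parent : ∀ v, d v ≠ 0 → ∃ p, G.Adj v p ∧ d p + 1 = d v
  root_unique : ∀ ⦃u v⦄, G.Reachable u v → d u = 0 → d v = 0 → u = v

theorem exists_isLayering {V : Type*} (G : SimpleGraph V) : ∃ d, IsLayering G d := by
  let r : V → V := fun v => (G.connectedComponentMk v).out
  have hr : ∀ v, G.Reachable v (r v) := fun v =>
    (SimpleGraph.ConnectedComponent.exact (Quot.out_eq (G.connectedComponentMk v))).symm
  have hrr : ∀ {u v}, G.Reachable u v → r u = r v := fun h => by
    simp only [r, SimpleGraph.ConnectedComponent.sound h]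
  have h1 : ∀ {u v}, G.Adj u v → G.dist u (r u) ≤ G.dist v (r v) + 1 := by
    intro u v h
    rw [hrr h.reachable]
    obtain ⟨w, hw⟩ := (hr v).exists_walk_length_eq_dist
    rw [← hw]
    exact SimpleGraph.dist_le (.cons h w)
  have h2 : ∀ {v x}, G.dist v x ≠ 0 → ∃ p, G.Adj v p ∧ G.dist p x + 1 = G.dist v x := by
    intro v x hv
    obtain ⟨w, hw⟩ := SimpleGraph.exists_walk_of_dist_ne_zero hv
    cases w with
    | nil => exact absurd hw.symm hv
    | cons h w =>
      rw [SimpleGraph.Walk.length_cons] at hw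
      obtain ⟨w', hw'⟩ := w.reachable.exists_walk_length_eq_dist
      have h3 := SimpleGraph.dist_le w
      have h4 := SimpleGraph.dist_le (.cons h w')
      rw [SimpleGraph.Walk.length_cons] at h4
      exact ⟨_, h, by omega⟩
  refine ⟨fun v => G.dist v (r v), ⟨fun u v h => h1 h, fun v hv => ?_, fun u v h hu hv => ?_⟩⟩
  · obtain ⟨p, hp, hdp⟩ := h2 hv
    exact ⟨p, hp, by rw [← hrr hp.reachable, hdp]⟩
  · rw [(hr u).dist_eq_zero_iff] at hu
    rw [(hr v).dist_eq_zero_iff] at hv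
    rw [hu, hv, hrr h]

namespace IsLayering

variable {V : Type*} {G : SimpleGraph V} {d : V → ℕ}

theorem exists_walk_root (hd : IsLayering G d) : ∀ (n : ℕ) (v : V), d v = n →
    ∃ r, d r = 0 ∧ ∃ w : G.Walk v r, ∀ t ∈ w.support, d t ≤ n := by
  intro n
  induction n with
  | zero => exact fun v hv => ⟨v, hv, .nil, by simp [hv]⟩
  | succ n ih =>
    intro v hv
    obtain ⟨p, hp, hdp⟩ := hd.exists_parent v (by omega)
    obtain ⟨r, hr, w, hw⟩ := ih p (by omega)
    refine ⟨r, hr, .cons hp w, fun t ht => ?_⟩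
    rw [SimpleGraph.Walk.support_cons, List.mem_cons] at ht
    rcases ht with rfl | ht
    · exact hv.le
    · exact (hw t ht).trans n.le_succ

theorem exists_path (hd : IsLayering G d) {n : ℕ} {u v : V} (h : G.Reachable u v) (hu : d u = n)
    (hv : d v = n) : ∃ q : G.Walk u v, q.IsPath ∧ ∀ t ∈ q.support, d t ≤ n := by
  classical
  obtain ⟨r, hr, w, hw⟩ := hd.exists_walk_root n u hu
  obtain ⟨r', hr', w', hw'⟩ := hd.exists_walk_root n v hv
  obtain rfl := hd.root_unique ((w.reachable.symm.trans h).trans w'.reachable) hr hr'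
  refine ⟨(w.append w'.reverse).bypass, SimpleGraph.Walk.bypass_isPath _, fun t ht => ?_⟩
  have ht' := SimpleGraph.Walk.support_bypass_subset_support _ ht
  rw [SimpleGraph.Walk.mem_support_append_iff, SimpleGraph.Walk.support_reverse,
    List.mem_reverse] at ht'
  exact ht'.elim (hw t) (hw' t)

theorem ne_zero_of_adj (hd : IsLayering G d) {u v : V} (h : G.Adj u v) (huv : d u = d v) :
    d v ≠ 0 :=
  fun h0 => h.ne (hd.root_unique h.reachable (huv.trans h0) h0)

variable [Finite V]

/-- A path between parents of `u` and `v` that stays in lower layers closes up through the edge `uv`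
to a cycle, hence a clique. -/
theorem adj_parent_of_adj (hd : IsLayering G d) (hG : IsBlockGraph G) {u v p : V}
    (h : G.Adj u v) (huv : d u = d v) (hp : G.Adj u p) (hdp : d p + 1 = d u) : G.Adj v p := by
  obtain ⟨p', hp', hdp'⟩ := hd.exists_parent v (hd.ne_zero_of_adj h huv)
  obtain ⟨q, hq, hqd⟩ := hd.exists_path (n := d p)
    ((hp.symm.reachable.trans h.reachable).trans hp'.reachable) rfl (by omega)
  have hvq : v ∉ q.support := fun hm => by have := hqd v hm; omega
  have huq : u ∉ (q.concat hp'.symm).support := by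
    rw [SimpleGraph.Walk.support_concat, List.mem_append,
      List.mem_singleton]
    rintro (hm | rfl)
    · have := hqd u hm
      omega
    · exact h.ne rfl
  refine hG.isClique_cycle (q.concat hp'.symm) (hq.concat hvq hp'.symm) huq hp h
    (Or.inr ?_) (Or.inr ?_) ?_
  · exact SimpleGraph.Walk.end_mem_support _
  · exact SimpleGraph.Walk.start_mem_support _
  · rintro rfl
    omega

/-- Two parents would be adjacent, hence have a common parent `t`; the 4-cycle `v`, `p`, `t`, `p'`
would then make `v` adjacent to `t`, two layers away. -/
theorem parent_unique (hd : IsLayering G d) (hG : IsBlockGraph G) {v p p' : V}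
    (hp : G.Adj v p) (hdp : d p + 1 = d v) (hp' : G.Adj v p') (hdp' : d p' + 1 = d v) :
    p = p' := by
  by_contra hne
  obtain ⟨q, hq, hqd⟩ := hd.exists_path (n := d p) (hp.symm.reachable.trans hp'.reachable) rfl
    (by omega)
  have hpp : G.Adj p p' := hG.isClique_cycle q hq (fun hm => by have := hqd v hm; omega) hp hp'
    (Or.inr q.start_mem_support) (Or.inr q.end_mem_support) hne
  have hdd : d p' = d p := by omega
  obtain ⟨t, ht, hdt⟩ := hd.exists_parent p (hd.ne_zero_of_adj hpp.symm hdd)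
  have ht' : G.Adj p' t := hd.adj_parent_of_adj hG hpp hdd.symm ht hdt
  have hvt : v ≠ t := by rintro rfl; omega
  have hadj : G.Adj v t := hG.isClique_cycle (.cons ht (.cons ht'.symm .nil))
    (by simp [ht.ne, ht'.ne.symm, hne])
    (by simp [hp.ne, hp'.ne, hvt]) hp hp' (Or.inl rfl) (Or.inr (by simp)) hvt
  have := hd.le_add_one hadj
  omega

theorem adj_trans (hd : IsLayering G d) (hG : IsBlockGraph G) {u v w : V}
    (huv : G.Adj u v) (hduv : d u = d v) (hvw : G.Adj v w) (hdvw : d v = d w) (huw : u ≠ w) :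
    G.Adj u w := by
  obtain ⟨p, hp, hdp⟩ := hd.exists_parent u (hd.ne_zero_of_adj huv.symm hduv.symm)
  have hpv := hd.adj_parent_of_adj hG huv hduv hp hdp
  have hpw := hd.adj_parent_of_adj hG hvw hdvw hpv (by omega)
  exact hG.isClique_cycle (.cons huv (.cons hvw .nil)) (by simp [huv.ne, hvw.ne, huw])
    (by simp [hp.ne.symm, hpv.ne.symm, hpw.ne.symm]) hp.symm hpw.symm
    (Or.inr (by simp)) (Or.inr (by simp)) huw

/-- The equivalence relation whose classes are the blocks without their vertex in the least
layer. -/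
def siblingSetoid (hd : IsLayering G d) (hG : IsBlockGraph G) : Setoid V where
  r u v := u = v ∨ (G.Adj u v ∧ d u = d v)
  iseqv :=
    { refl := fun _ => Or.inl rfl
      symm := by
        rintro u v (rfl | ⟨h, h'⟩)
        · exact Or.inl rfl
        · exact Or.inr ⟨h.symm, h'.symm⟩
      trans := by
        rintro u v w (rfl | ⟨h1, h2⟩) (rfl | ⟨h3, h4⟩)
        · exact Or.inl rfl
        · exact Or.inr ⟨h3, h4⟩
        · exact Or.inr ⟨h1, h2⟩
        · by_cases huw : u = w
          · exact Or.inl huw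
          · exact Or.inr ⟨hd.adj_trans hG h1 h2 h3 h4 huw, h2.trans h4⟩ }

end IsLayering

end EPG

/-! ### The labelling of a block graph -/

open EPG in
theorem mainTheorem6 {V : Type*} [Finite V] (G : SimpleGraph V) (hG : EPG.IsBlockGraph G) :
    EPG.IsHellyBkEPG 1 G := by
  classical
  obtain ⟨d, hd⟩ := exists_isLayering G
  let S := hd.siblingSetoid hG
  obtain ⟨n, ⟨e⟩⟩ := Finite.exists_equiv_fin V
  -- The index of a chosen representative numbers the sibling groups.
  let g : V → ℕ := fun v => e (Quotient.mk S v).out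
  have hg : ∀ v, g v < n := fun v => (e _).2
  have hgr : ∀ u v, g u = g v ↔ u = v ∨ (G.Adj u v ∧ d u = d v) := by
    intro u v
    rw [← Fin.ext_iff, e.injective.eq_iff, Quotient.out_inj]
    exact Quotient.eq (r := S)
  have hpar : ∀ v, ∃ p, d v ≠ 0 → G.Adj v p ∧ d p + 1 = d v := fun v => by
    by_cases h : d v = 0
    · exact ⟨v, fun h' => absurd h h'⟩
    · obtain ⟨p, hp⟩ := hd.exists_parent v h
      exact ⟨p, fun _ => hp⟩
  choose par hpar using hpar
  -- Ordering groups by layer first puts parents before children. Factor `n + 1` leaves each group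
  -- room for its start `s` and `n` distinct later positions `f`. Roots are attached to line `0`,
  -- which nobody owns since `f` is positive.
  let c : V → ℕ := fun v => d v * n + g v
  let s : V → ℕ := fun v => c v * (n + 1)
  let f : V → ℕ := fun v => s v + (e v : ℕ) + 1
  let q : V → ℕ := fun v => if d v = 0 then 0 else f (par v)
  have hsf : ∀ v, s v < f v := fun v => by simp only [f]; omega
  have hcs : ∀ u v, c u < c v → f u ≤ s v := by
    intro u v h
    have h1 : (c u + 1) * (n + 1) ≤ c v * (n + 1) := Nat.mul_le_mul_right _ h
    have h2 := (e u).2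
    simp only [f, s]
    rw [add_mul] at h1
    omega
  have hf : Function.Injective f := by
    intro u v h
    rcases lt_trichotomy (c u) (c v) with h1 | h1 | h1
    · exact absurd h ((hcs u v h1).trans_lt (hsf v)).ne
    · simp only [f, s, h1] at h
      exact e.injective (Fin.ext (by omega))
    · exact absurd h ((hcs v u h1).trans_lt (hsf u)).ne'
  have hcp : ∀ v, d v ≠ 0 → c (par v) < c v := by
    intro v hv
    have h1 := (hpar v hv).2
    have h2 := hg (par v)
    simp only [c]
    rw [← h1, add_mul]
    omega
  have hqf : ∀ u v, q v = f u → d v ≠ 0 ∧ par v = u := by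
    intro u v h
    by_cases hv : d v = 0
    · have := hsf u
      simp only [q, hv, if_true] at h
      omega
    · simp only [q, hv, if_false] at h
      exact ⟨hv, hf h⟩
  have hqd : ∀ u v, q u = q v → d u = d v := by
    intro u v h
    by_cases hu : d u = 0
    · by_cases hv : d v = 0
      · omega
      · exact absurd hu (hqf (par v) u (by rw [h]; simp [q, hv])).1
    · obtain ⟨hv, hp⟩ := hqf (par u) v (by rw [← h]; simp [q, hu])
      rw [← (hpar u hu).2, ← (hpar v hv).2, hp]
  refine isHellyBkEPG_of_labelling G (fun v => f v) (fun v => q v) (fun v => s v)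
    (fun v => decide (Even (d v))) (fun u v h => hf (Nat.cast_injective h)) ?_ ?_ ?_ ?_ ?_ ?_
  all_goals simp only [Nat.cast_inj, Nat.cast_le, Nat.cast_lt, ne_eq]
  · intro v
    by_cases hv : d v = 0
    · simp [q, hv]
    · simpa [q, hv] using hcs _ _ (hcp v hv)
  · exact hsf
  · intro u v h
    obtain ⟨hv, rfl⟩ := hqf u v h
    rw [← (hpar v hv).2, ← decide_not, decide_eq_decide]
    exact Nat.even_add_one
  · intro u v h
    rw [hqd u v h]
  · intro u v _ h
    rcases lt_trichotomy (c u) (c v) with h1 | h1 | h1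
    · exact Or.inl (hcs u v h1)
    · exact absurd (by simp only [s, h1]) h
    · exact Or.inr (hcs v u h1)
  · have hup : ∀ u v, G.Adj u v → d u + 1 = d v → q v = f u := by
      intro u v h hdu
      have hv : d v ≠ 0 := by omega
      simp only [q, hv, if_false]
      rw [hd.parent_unique hG (hpar v hv).1 (hpar v hv).2 h.symm hdu]
    intro u v huv
    constructor
    · intro h
      have h1 := hd.le_add_one h
      have h2 := hd.le_add_one h.symm
      rcases lt_trichotomy (d u) (d v) with h3 | h3 | h3
      · exact Or.inl (hup u v h (by omega))
      · have hv := hd.ne_zero_of_adj h h3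
        have hu : d u ≠ 0 := by omega
        refine Or.inr (Or.inr ⟨?_, ?_⟩)
        · simp only [q, hu, hv, if_false]
          rw [hd.parent_unique hG (hpar v hv).1 (hpar v hv).2
            (hd.adj_parent_of_adj hG h h3 (hpar u hu).1 (hpar u hu).2)
            ((hpar u hu).2.trans h3)]
        · simp only [s, c, h3, (hgr u v).2 (Or.inr ⟨h, h3⟩)]
      · exact Or.inr (Or.inl (hup v u h.symm (by omega)))
    · rintro (h | h | ⟨h, h'⟩)
      · obtain ⟨hv, rfl⟩ := hqf u v h
        exact (hpar v hv).1.symm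
      · obtain ⟨hu, rfl⟩ := hqf v u h
        exact (hpar u hu).1
      · have hc : c u = c v := Nat.eq_of_mul_eq_mul_right n.succ_pos h'
        simp only [c, hqd u v h, add_right_inj] at hc
        exact (((hgr u v).1 hc).resolve_left huv).1
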